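/- Let $G$ be a finite bipartite permutation graph, that is, a bipartite graph that is isomorphic to the inversion graph of a permutation $\pi$ of $\{1,\dots,n\}$ for some $n$ (the graph on $\{1,\dots,n\}$ in which $i<j$ are adjacent if and only if $\pi(i)>\pi(j)$). For a path $P$ in $G$ (a single vertex counts as a path), let \[ \mathrm{ecc}_G(P) := \max_{u\in V(G)}\ \min_{v\in V(P)} d_G(u,v), \] where $d_G(u,v)=\infty$ if $u$ and $v$ lie in different components of $G$. A path $P$ is a \emph{central path} of $G$ if $\mathrm{ecc}_G(P)\le \mathrm{ecc}_G(Q)$ for every path $Q$ in $G$. Then every longest path of $G$ (a path of maximum length among all paths of $G$) is a central path of $G$. -/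

import Mathlib

namespace SimpleGraph

/-- The inversion graph of a permutation `π` of `{0, …, n - 1}`: two elements are adjacent
exactly when `π` reverses their order. -/
def inversionGraph {n : ℕ} (π : Equiv.Perm (Fin n)) : SimpleGraph (Fin n) where
  Adj i j := (i < j ∧ π j < π i) ∨ (j < i ∧ π i < π j)
  symm := ⟨fun _ _ h => Or.symm h⟩
  loopless := ⟨fun i h => h.elim (fun h => lt_irrefl i h.1) (fun h => lt_irrefl i h.1)⟩

variable {V : Type*}

/-- A (finite) permutation graph: a graph isomorphic to the inversion graph of a permutation. -/
def IsPermutationGraph (G : SimpleGraph V) : Prop :=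
  ∃ (n : ℕ) (π : Equiv.Perm (Fin n)), Nonempty (G ≃g inversionGraph π)

/-- A bipartite permutation graph: a permutation graph that is bipartite. -/
def IsBipartitePermutationGraph (G : SimpleGraph V) : Prop :=
  G.IsBipartite ∧ G.IsPermutationGraph

/-- The distance `d_G(u, S) = min {d_G(u, v) : v ∈ S}`, which is `⊤` if no vertex of `S` is
reachable from `u`. -/
noncomputable def distToSet (G : SimpleGraph V) (u : V) (S : Set V) : ℕ∞ :=
  ⨅ v ∈ S, G.edist u v

namespace Walk

variable {G : SimpleGraph V} {a b : V}

/-- The eccentricity `ecc_G(P) = max {d_G(u, V(P)) : u ∈ V(G)}`. -/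
noncomputable def ecc (P : G.Walk a b) : ℕ∞ :=
  ⨆ u : V, G.distToSet u {v | v ∈ P.support}

/-- A path of minimum eccentricity among all paths of the graph. -/
def IsCentralPath (P : G.Walk a b) : Prop :=
  P.IsPath ∧ ∀ (c d : V) (Q : G.Walk c d), Q.IsPath → P.ecc ≤ Q.ecc

/-- A path of maximum length among all paths of the graph. -/
def IsLongestPath (P : G.Walk a b) : Prop :=
  P.IsPath ∧ ∀ (c d : V) (Q : G.Walk c d), Q.IsPath → Q.length ≤ P.length

end Walk

end SimpleGraph

/-! If some path has finite eccentricity, the graph is connected, and then a longest path dominates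
it (`dominating`), so has eccentricity at most 1; if some path has eccentricity 0 it is Hamiltonian,
and so is every longest path. For domination, draw vertices as points, with edges from upper left to
lower right; bipartiteness forbids chains of three. If a path is not dominating, some `u` at
distance two from it has a neighbour `w` adjacent to the path. Up to symmetry the path stays left of
`u`, and `w` is adjacent to its rightmost upper vertex `q`. The path can be rearranged to start at
`q` at the cost of at most one vertex (`exists_path_cons`); prepending `u, w` makes it longer. -/

namespace SimpleGraph

variable {V : Type*} {G : SimpleGraph V}

/-- A planar representation of a triangle-free permutation graph: the vertices are points with
pairwise distinct abscissas and ordinates, two of them are adjacent exactly when one lies to the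
upper left of the other, and there is no chain of three such points. -/
structure PlanarRep (G : SimpleGraph V) where
  x : V → ℤ
  y : V → ℤ
  x_inj : Function.Injective x
  y_inj : Function.Injective y
  adj_iff : ∀ a b, G.Adj a b ↔ (x a < x b ∧ y b < y a) ∨ (x b < x a ∧ y a < y b)
  no_chain : ∀ a b c, x a < x b → y b < y a → x b < x c → y c < y b → False

namespace PlanarRep

/-- Reflection in the main diagonal. -/
def swap (R : PlanarRep G) : PlanarRep G where
  x := R.y
  y := R.x
  x_inj := R.y_inj
  y_inj := R.x_inj
  adj_iff a b := by rw [R.adj_iff]; tauto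
  no_chain a b c h1 h2 h3 h4 := R.no_chain c b a h4 h3 h2 h1

/-- Reflection in the antidiagonal. -/
def flip (R : PlanarRep G) : PlanarRep G where
  x v := -R.y v
  y v := -R.x v
  x_inj a b h := R.y_inj (neg_injective h)
  y_inj a b h := R.x_inj (neg_injective h)
  adj_iff a b := by rw [R.adj_iff]; simp only [neg_lt_neg_iff]; tauto
  no_chain a b c h1 h2 h3 h4 := by
    simp only [neg_lt_neg_iff] at *
    exact R.no_chain a b c h2 h1 h4 h3

/-- `a` lies to the upper left of some other vertex. -/
def Upper (R : PlanarRep G) (a : V) : Prop := ∃ b, R.x a < R.x b ∧ R.y b < R.y a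

variable (R : PlanarRep G)

theorem Upper.of_adj {R : PlanarRep G} {a b : V} (ha : R.Upper a) (h : G.Adj a b) :
    R.x a < R.x b ∧ R.y b < R.y a := by
  obtain ⟨c, h1, h2⟩ := ha
  rcases (R.adj_iff a b).1 h with h | h
  · exact h
  · exact (R.no_chain b a c h.1 h.2 h1 h2).elim

/-- Otherwise `b` would be the middle of a chain. Hence abscissa and ordinate order the upper
vertices alike. -/
theorem Upper.y_lt {R : PlanarRep G} {a b : V} (hb : R.Upper b) (h : R.x a < R.x b) :
    R.y a < R.y b := by
  obtain ⟨c, h1, h2⟩ := hb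
  rcases lt_trichotomy (R.y a) (R.y b) with h' | h' | h'
  · exact h'
  · rw [R.y_inj h'] at h
    exact (lt_irrefl _ h).elim
  · exact (R.no_chain a b c h h' h1 h2).elim

theorem exists_max_upper {l : List V} {p : V} (hp : p ∈ l) (hpu : R.Upper p) :
    ∃ q ∈ l, R.Upper q ∧ ∀ a ∈ l, R.Upper a → R.x a ≤ R.x q := by
  classical
  obtain ⟨q, hq, hmax⟩ := (l.toFinset.filter R.Upper).exists_max_image R.x
    ⟨p, by simp [hp, hpu]⟩
  simp only [Finset.mem_filter, List.mem_toFinset] at hq hmax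
  exact ⟨q, hq.1, hq.2, fun a h1 h2 => hmax a ⟨h1, h2⟩⟩

/-- The two vertices around the rightmost upper vertex of a path can be cut out. -/
theorem adj_shortcut {p b₁ b₂ x₁ y₁ : V} (hp : R.Upper p) (h1 : G.Adj b₁ p) (h2 : G.Adj p b₂)
    (hx : G.Adj x₁ b₁) (hy : G.Adj b₂ y₁) (hyp : R.x y₁ ≤ R.x p)
    (hxu : R.Upper x₁) (hyu : R.Upper y₁) (hlt : R.x b₁ < R.x b₂) :
    G.Adj b₁ y₁ := by
  have e1 := hp.of_adj h1.symm
  have e2 := hp.of_adj h2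
  have e3 := hxu.of_adj hx
  have e4 := hyu.of_adj hy.symm
  have hb : R.y b₁ < R.y b₂ := by
    rcases lt_trichotomy (R.y b₁) (R.y b₂) with h' | h' | h'
    · exact h'
    · rw [R.y_inj h'] at hlt
      exact (lt_irrefl _ hlt).elim
    · exact (R.no_chain p b₁ b₂ e1.1 e1.2 hlt h').elim
  refine (R.adj_iff _ _).2 (Or.inr ⟨?_, by omega⟩)
  omega

/-- Cut `p, b₂` out of `… x₁ b₁ p b₂ y₁ …`, rearrange the rest by induction to start at its own
rightmost upper vertex `q`, and prepend `p, b₂`: the loss stays at most one. -/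
theorem exists_path_cons_aux (n : ℕ) : ∀ (l : List V), l.length = n → l.IsChain G.Adj → l.Nodup →
    ∀ p ∈ l, R.Upper p → (∀ a ∈ l, R.Upper a → R.x a ≤ R.x p) →
    ∃ m : List V, (p :: m).IsChain G.Adj ∧ (p :: m).Nodup ∧ (p :: m) ⊆ l ∧
      l.length ≤ (p :: m).length + 1 := by
  induction n using Nat.strong_induction_on with
  | _ n ih =>
  intro l hn hc hd p hp hpu hmax
  obtain ⟨X, Y, rfl⟩ := List.append_of_mem hp
  have key : ∀ (b₁ x₁ b₂ y₁ : V) (X Y : List V),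
      (X ++ x₁ :: b₁ :: p :: b₂ :: y₁ :: Y).length = n →
      (X ++ x₁ :: b₁ :: p :: b₂ :: y₁ :: Y).IsChain G.Adj →
      (X ++ x₁ :: b₁ :: p :: b₂ :: y₁ :: Y).Nodup →
      (∀ a ∈ X ++ x₁ :: b₁ :: p :: b₂ :: y₁ :: Y, R.Upper a → R.x a ≤ R.x p) →
      R.x b₁ < R.x b₂ →
      ∃ m : List V, (p :: m).IsChain G.Adj ∧ (p :: m).Nodup ∧
        (p :: m) ⊆ X ++ x₁ :: b₁ :: p :: b₂ :: y₁ :: Y ∧ n ≤ (p :: m).length + 1 := by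
    clear hp hc hd hmax hn X Y
    intro b₁ x₁ b₂ y₁ X Y hn hc hd hmax hlt
    rw [List.isChain_append] at hc
    obtain ⟨hcX, hcr, hcon⟩ := hc
    simp only [List.isChain_cons_cons] at hcr
    obtain ⟨hx, h1, h2, hy, hcY⟩ := hcr
    have e1 := hpu.of_adj h1.symm
    have e2 := hpu.of_adj h2
    have hxu : R.Upper x₁ := by
      rcases (R.adj_iff _ _).1 hx with h | h
      · exact ⟨_, h⟩
      · exact (R.no_chain _ _ _ e1.1 e1.2 h.1 h.2).elim
    have hyu : R.Upper y₁ := by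
      rcases (R.adj_iff _ _).1 hy with h | h
      · exact (R.no_chain _ _ _ e2.1 e2.2 h.1 h.2).elim
      · exact ⟨_, h⟩
    have hs : G.Adj b₁ y₁ := R.adj_shortcut hpu h1 h2 hx hy (hmax _ (by simp) hyu)
      hxu hyu hlt
    have hsub : (X ++ x₁ :: b₁ :: y₁ :: Y).Sublist (X ++ x₁ :: b₁ :: p :: b₂ :: y₁ :: Y) := by
      refine (List.Sublist.refl X).append (List.Sublist.cons_cons _ (List.Sublist.cons_cons _ ?_))
      exact (List.sublist_cons_self _ _).trans (List.sublist_cons_self _ _)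
    have hc' : (X ++ x₁ :: b₁ :: y₁ :: Y).IsChain G.Adj := by
      rw [List.isChain_append]
      refine ⟨hcX, ?_, by simpa using hcon⟩
      simp only [List.isChain_cons_cons]
      exact ⟨hx, hs, hcY⟩
    obtain ⟨q, hq, hqu, hqmax⟩ := R.exists_max_upper (l := X ++ x₁ :: b₁ :: y₁ :: Y) (p := y₁)
      (by simp) hyu
    obtain ⟨m, hm1, hm2, hm3, hm4⟩ := ih (X ++ x₁ :: b₁ :: y₁ :: Y).length
      (by rw [← hn]; simp) _ rfl hc' (hd.sublist hsub) q hq hqu hqmax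
    have hnot : p ∉ X ++ x₁ :: b₁ :: y₁ :: Y ∧ b₂ ∉ X ++ x₁ :: b₁ :: y₁ :: Y := by
      have hperm : (X ++ x₁ :: b₁ :: p :: b₂ :: y₁ :: Y).Perm
          (p :: b₂ :: (X ++ x₁ :: b₁ :: y₁ :: Y)) := by
        have := (List.perm_append_comm (l₁ := X ++ [x₁, b₁]) (l₂ := [p, b₂])).append_right (y₁ :: Y)
        simpa using this
      have := hperm.nodup_iff.1 hd
      simp only [List.nodup_cons, List.mem_cons, not_or] at this
      exact ⟨this.1.2, this.2.1⟩
    -- `q` lies between `y₁` and `p`, both upper neighbours of `b₂`.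
    have hqb : G.Adj b₂ q := by
      have h3 := hqmax y₁ (by simp) hyu
      have h4 := hmax q (hsub.subset hq) hqu
      have h5 := hyu.of_adj hy.symm
      refine (R.adj_iff _ _).2 (Or.inr ⟨by omega, ?_⟩)
      rcases h3.eq_or_lt with h | h
      · rw [← R.x_inj h]; exact h5.2
      · have := hqu.y_lt h; omega
    refine ⟨b₂ :: q :: m, ?_, ?_, ?_, ?_⟩
    · simp only [List.isChain_cons_cons]
      exact ⟨h2, hqb, hm1⟩
    · rw [List.nodup_cons, List.nodup_cons]
      refine ⟨?_, fun h => hnot.2 (hm3 h), hm2⟩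
      rw [List.mem_cons, not_or]
      exact ⟨h2.ne, fun h => hnot.1 (hm3 h)⟩
    · intro v hv
      rcases List.mem_cons.1 hv with rfl | hv
      · simp
      rcases List.mem_cons.1 hv with rfl | hv
      · simp
      exact hsub.subset (hm3 hv)
    · have : n = (X ++ x₁ :: b₁ :: y₁ :: Y).length + 2 := by rw [← hn]; simp; omega
      rw [this]
      simp only [List.length_cons] at hm4 ⊢
      omega
  -- Near an end of the path, dropping the at most one vertex beyond `p` suffices.
  have hYlen : X.length ≤ 1 → ∃ m : List V, (p :: m).IsChain G.Adj ∧ (p :: m).Nodup ∧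
      (p :: m) ⊆ X ++ p :: Y ∧ (X ++ p :: Y).length ≤ (p :: m).length + 1 := by
    intro hX
    refine ⟨Y, hc.right_of_append, hd.of_append_right, List.subset_append_right _ _, ?_⟩
    simp only [List.length_append, List.length_cons]
    omega
  have hXlen : Y.length ≤ 1 → ∃ m : List V, (p :: m).IsChain G.Adj ∧ (p :: m).Nodup ∧
      (p :: m) ⊆ X ++ p :: Y ∧ (X ++ p :: Y).length ≤ (p :: m).length + 1 := by
    intro hY
    have e : p :: X.reverse = (X ++ [p]).reverse := by simp
    have hs : (X ++ [p]).Sublist (X ++ p :: Y) :=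
      (List.Sublist.refl X).append (List.Sublist.cons_cons _ (List.nil_sublist _))
    have hc' : (X ++ [p]).IsChain G.Adj := by
      have : ((X ++ [p]) ++ Y).IsChain G.Adj := by simpa using hc
      exact this.left_of_append
    refine ⟨X.reverse, ?_, ?_, ?_, ?_⟩
    · rw [e, List.isChain_reverse]
      exact hc'.imp fun _ _ h => h.symm
    · rw [e, List.nodup_reverse]; exact hd.sublist hs
    · rw [e]; intro v hv; exact hs.subset (List.mem_reverse.1 hv)
    · simp only [List.length_append, List.length_cons, List.length_reverse]
      omega
  rcases Y with _ | ⟨b₂, _ | ⟨y₁, Y⟩⟩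
  · exact hXlen (by simp)
  · exact hXlen (by simp)
  rcases List.eq_nil_or_concat' X with rfl | ⟨X, b₁, rfl⟩
  · exact hYlen (by simp)
  rcases List.eq_nil_or_concat' X with rfl | ⟨X, x₁, rfl⟩
  · exact hYlen (by simp)
  have e : X ++ [x₁] ++ [b₁] ++ p :: b₂ :: y₁ :: Y = X ++ x₁ :: b₁ :: p :: b₂ :: y₁ :: Y := by simp
  rw [e] at hn hc hd hmax ⊢
  rcases lt_trichotomy (R.x b₁) (R.x b₂) with h | h | h
  · rw [hn]
    exact key b₁ x₁ b₂ y₁ X Y hn hc hd hmax h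
  · have := R.x_inj h
    subst this
    simp [List.nodup_append] at hd
  · have er : (X ++ x₁ :: b₁ :: p :: b₂ :: y₁ :: Y).reverse =
        Y.reverse ++ y₁ :: b₂ :: p :: b₁ :: x₁ :: X.reverse := by simp
    obtain ⟨m, h1, h2, h3, h4⟩ := key b₂ y₁ b₁ x₁ Y.reverse X.reverse
      (by rw [← er, List.length_reverse, hn])
      (by rw [← er, List.isChain_reverse]; exact hc.imp fun _ _ h => h.symm)
      (by rw [← er, List.nodup_reverse]; exact hd)
      (by rw [← er]; exact fun a ha => hmax a (List.mem_reverse.1 ha)) h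
    rw [← er] at h3
    exact ⟨m, h1, h2, fun v hv => List.mem_reverse.1 (h3 hv), by rw [hn]; exact h4⟩

/-- Up to the loss of one vertex, a path can be rearranged to start at its rightmost upper
vertex. -/
theorem exists_path_cons {l : List V} (hc : l.IsChain G.Adj) (hd : l.Nodup) {p : V} (hp : p ∈ l)
    (hpu : R.Upper p) (hmax : ∀ a ∈ l, R.Upper a → R.x a ≤ R.x p) :
    ∃ m : List V, (p :: m).IsChain G.Adj ∧ (p :: m).Nodup ∧ (p :: m) ⊆ l ∧
      l.length ≤ (p :: m).length + 1 :=
  R.exists_path_cons_aux l.length l rfl hc hd p hp hpu hmax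

end PlanarRep

theorem forall_mem_of_isChain {S : V → Prop} : ∀ {l : List V}, l.IsChain G.Adj →
    (∀ a ∈ l, ∀ b ∈ l, G.Adj a b → S a → S b) → ∀ {p : V}, p ∈ l → S p → ∀ v ∈ l, S v
  | [], _, _, _, hp, _ => by simp at hp
  | [a], _, _, p, hp, hS => by
    intro v hv
    simp only [List.mem_singleton] at hp hv
    rwa [hv, ← hp]
  | a :: b :: l, hc, hinv, p, hp, hS => by
    rw [List.isChain_cons_cons] at hc
    have ih : ∀ {q : V}, q ∈ b :: l → S q → ∀ v ∈ b :: l, S v :=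
      forall_mem_of_isChain hc.2 fun a ha b hb =>
      hinv a (List.mem_cons_of_mem _ ha) b (List.mem_cons_of_mem _ hb)
    have hb : S b := by
      rcases List.mem_cons.1 hp with rfl | hp
      · exact hinv p (by simp) b (by simp) hc.1 hS
      · exact ih hp hS b (by simp)
    intro v hv
    rcases List.mem_cons.1 hv with rfl | hv
    · exact hinv b (by simp) v (by simp) hc.1.symm hb
    · exact ih (q := b) (by simp) hb v hv

/-! ### Lengthening a non-dominating path -/

namespace PlanarRep

variable (R : PlanarRep G)

/-- A path that misses the neighbourhood of a vertex at distance two on its right can be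
replaced by a longer one. -/
theorem exists_longer_of_right {l : List V} (hc : l.IsChain G.Adj) (hd : l.Nodup) {p w u : V}
    (hp : p ∈ l) (hw : w ∉ l) (hul : u ∉ l) (hu : ∀ v ∈ l, ¬ G.Adj u v)
    (hpw : R.x p < R.x w ∧ R.y w < R.y p) (huw : R.x u < R.x w ∧ R.y w < R.y u)
    (hlt : R.x p < R.x u) :
    ∃ m : List V, m.IsChain G.Adj ∧ m.Nodup ∧ l.length < m.length := by
  have huu : R.Upper u := ⟨w, huw⟩
  -- An edge of the path crossing to the right of `u` would end below `u`, hence at a neighbour of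
  -- `u`.
  have hall : ∀ v ∈ l, R.x v < R.x u := by
    refine forall_mem_of_isChain (S := fun v => R.x v < R.x u) hc ?_ hp hlt
    intro a ha b hb hab hau
    rcases (R.adj_iff _ _).1 hab with h | h
    · have h1 := huu.y_lt hau
      have h2 := hu b hb
      rw [R.adj_iff] at h2
      have h3 : R.x b ≠ R.x u := fun h => hul (R.x_inj h ▸ hb)
      omega
    · exact h.1.trans hau
  obtain ⟨q, hq, hqu, hqmax⟩ := R.exists_max_upper hp ⟨w, hpw⟩
  obtain ⟨m, h1, h2, h3, h4⟩ := R.exists_path_cons hc hd hq hqu hqmax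
  have hqw : G.Adj w q := by
    have h5 := hall q hq
    refine (R.adj_iff _ _).2 (Or.inr ⟨by omega, ?_⟩)
    rcases (hqmax p hp ⟨w, hpw⟩).eq_or_lt with h | h
    · rw [← R.x_inj h]; exact hpw.2
    · have := hqu.y_lt h; omega
  have huw' : G.Adj u w := (R.adj_iff _ _).2 (Or.inl huw)
  refine ⟨u :: w :: q :: m, ?_, ?_, ?_⟩
  · simp only [List.isChain_cons_cons]
    exact ⟨huw', hqw, h1⟩
  · rw [List.nodup_cons, List.nodup_cons, List.mem_cons, not_or]
    exact ⟨⟨huw'.ne, fun h => hul (h3 h)⟩, fun h => hw (h3 h), h2⟩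
  · simp only [List.length_cons] at *
    omega

theorem exists_longer_of_upper {l : List V} (hc : l.IsChain G.Adj) (hd : l.Nodup) {p w u : V}
    (hp : p ∈ l) (hw : w ∉ l) (hul : u ∉ l) (hu : ∀ v ∈ l, ¬ G.Adj u v)
    (hpw : R.x p < R.x w ∧ R.y w < R.y p) (huw : R.x u < R.x w ∧ R.y w < R.y u) :
    ∃ m : List V, m.IsChain G.Adj ∧ m.Nodup ∧ l.length < m.length := by
  rcases lt_trichotomy (R.x p) (R.x u) with h | h | h
  · exact R.exists_longer_of_right hc hd hp hw hul hu hpw huw h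
  · exact (hul (R.x_inj h ▸ hp)).elim
  · have hpu : R.Upper p := ⟨w, hpw⟩
    -- The antidiagonal reflection keeps upper vertices upper and reverses their order.
    exact R.flip.exists_longer_of_right hc hd hp hw hul hu
      ⟨neg_lt_neg hpw.2, neg_lt_neg hpw.1⟩ ⟨neg_lt_neg huw.2, neg_lt_neg huw.1⟩
      (neg_lt_neg (hpu.y_lt h))

theorem exists_longer (R : PlanarRep G) {l : List V} (hc : l.IsChain G.Adj) (hd : l.Nodup)
    {p w u : V} (hp : p ∈ l) (hw : w ∉ l) (hul : u ∉ l) (hu : ∀ v ∈ l, ¬ G.Adj u v)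
    (hpw : G.Adj p w) (huw : G.Adj u w) :
    ∃ m : List V, m.IsChain G.Adj ∧ m.Nodup ∧ l.length < m.length := by
  rcases (R.adj_iff _ _).1 hpw with h1 | h1 <;> rcases (R.adj_iff _ _).1 huw with h2 | h2
  · exact R.exists_longer_of_upper hc hd hp hw hul hu h1 h2
  · exact (R.no_chain _ _ _ h1.1 h1.2 h2.1 h2.2).elim
  · exact (R.no_chain _ _ _ h2.1 h2.2 h1.1 h1.2).elim
  · exact R.swap.exists_longer_of_upper hc hd hp hw hul hu h1.symm h2.symm

end PlanarRep

theorem IsBipartitePermutationGraph.nonempty_planarRep (hG : G.IsBipartitePermutationGraph) :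
    Nonempty (PlanarRep G) := by
  obtain ⟨⟨c⟩, n, π, ⟨φ⟩⟩ := hG
  have hadj : ∀ a b, G.Adj a b ↔
      (((φ a : ℕ) : ℤ) < (φ b : ℕ) ∧ ((π (φ b) : ℕ) : ℤ) < (π (φ a) : ℕ))
      ∨ (((φ b : ℕ) : ℤ) < (φ a : ℕ) ∧ ((π (φ a) : ℕ) : ℤ) < (π (φ b) : ℕ)) := by
    intro a b
    rw [← φ.map_adj_iff]
    simp only [inversionGraph, Nat.cast_lt, Fin.val_fin_lt]
  refine ⟨⟨fun v => (φ v : ℕ), fun v => (π (φ v) : ℕ), ?_, ?_, hadj, ?_⟩⟩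
  · intro a b h
    exact φ.injective (Fin.ext (by simpa using h))
  · intro a b h
    exact φ.injective (π.injective (Fin.ext (by simpa using h)))
  · intro a b d h1 h2 h3 h4
    have e1 := c.valid ((hadj a b).2 (Or.inl ⟨h1, h2⟩))
    have e2 := c.valid ((hadj b d).2 (Or.inl ⟨h3, h4⟩))
    have e3 := c.valid ((hadj a d).2 (Or.inl ⟨h1.trans h3, h4.trans h2⟩))
    omega

theorem exists_isPath_length_eq {a : V} {l : List V} (hc : (a :: l).IsChain G.Adj)
    (hd : (a :: l).Nodup) : ∃ (b : V) (Q : G.Walk a b), Q.IsPath ∧ Q.length = l.length := by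
  have : ∃ (b : V) (Q : G.Walk a b), Q.support = a :: l := by
    clear hd
    induction l generalizing a with
    | nil => exact ⟨a, Walk.nil, rfl⟩
    | cons c l ih =>
      rw [List.isChain_cons_cons] at hc
      obtain ⟨b, Q, hQ⟩ := ih hc.2
      exact ⟨b, Walk.cons hc.1 Q, by rw [Walk.support_cons, hQ]⟩
  obtain ⟨b, Q, hQ⟩ := this
  refine ⟨b, Q, Walk.IsPath.mk' (hQ ▸ hd), ?_⟩
  have := Q.length_support
  rw [hQ, List.length_cons] at this
  omega

/-! ### Eccentricity and domination -/

namespace Walk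

variable {a b : V} {P : G.Walk a b}

theorem ecc_le_iff {k : ℕ∞} :
    P.ecc ≤ k ↔ ∀ u, G.distToSet u {v | v ∈ P.support} ≤ k := iSup_le_iff

theorem exists_edist_eq_distToSet (P : G.Walk a b) (u : V) :
    ∃ v ∈ P.support, G.edist u v = G.distToSet u {v | v ∈ P.support} := by
  have hne : Nonempty {v | v ∈ P.support} := ⟨⟨a, P.start_mem_support⟩⟩
  obtain ⟨⟨v, hv⟩, h⟩ := ENat.exists_eq_iInf fun v : {v | v ∈ P.support} => G.edist u v
  refine ⟨v, hv, h.trans ?_⟩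
  rw [distToSet, iInf_subtype']

theorem preconnected_of_ecc_ne_top (h : P.ecc ≠ ⊤) : G.Preconnected := by
  classical
  have hr : ∀ u, G.Reachable u a := by
    intro u
    obtain ⟨v, hv, huv⟩ := P.exists_edist_eq_distToSet u
    have : G.edist u v ≠ ⊤ := by
      rw [huv]
      exact ne_top_of_le_ne_top h (ecc_le_iff.1 le_rfl u)
    exact (reachable_of_edist_ne_top this).trans ⟨(P.takeUntil v hv).reverse⟩
  exact fun u v => (hr u).trans (hr v).symm

theorem ecc_eq_zero_iff : P.ecc = 0 ↔ ∀ u, u ∈ P.support := by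
  rw [← nonpos_iff_eq_zero, ecc_le_iff]
  refine forall_congr' fun u => ⟨fun h => ?_, fun h => ?_⟩
  · obtain ⟨v, hv, huv⟩ := P.exists_edist_eq_distToSet u
    rw [nonpos_iff_eq_zero.1 h, edist_eq_zero_iff] at huv
    rwa [huv]
  · exact (iInf₂_le u h).trans (by simp)

theorem IsLongestPath.ecc_eq_zero [Finite V] (hP : P.IsLongestPath) {c d : V} {Q : G.Walk c d}
    (hQ : Q.IsPath) (h : Q.ecc = 0) : P.ecc = 0 := by
  classical
  have := Fintype.ofFinite V
  rw [ecc_eq_zero_iff] at h ⊢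
  have h1 : Q.support.toFinset = Finset.univ := by ext; simp [h]
  have h2 : P.support.toFinset = Finset.univ := by
    rw [← Finset.card_eq_iff_eq_univ]
    refine le_antisymm (Finset.card_le_univ _) ?_
    rw [← Finset.card_univ, ← h1, List.toFinset_card_of_nodup hQ.support_nodup,
      List.toFinset_card_of_nodup hP.1.support_nodup, length_support, length_support]
    exact Nat.succ_le_succ (hP.2 c d Q hQ)
  intro u
  rw [← List.mem_toFinset, h2]
  exact Finset.mem_univ u

/-- In a connected bipartite permutation graph the longest paths are dominating. -/
theorem IsLongestPath.dominating (hP : P.IsLongestPath) (R : PlanarRep G) (hG : G.Preconnected)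
    (u : V) : u ∈ P.support ∨ ∃ v ∈ P.support, G.Adj u v := by
  by_contra hu
  obtain ⟨Q⟩ := hG a u
  -- A walk from the path to `u` must leave the closed neighbourhood of the path along some edge.
  obtain ⟨d, -, hd1, hd2⟩ := Q.exists_boundary_dart
    {u | u ∈ P.support ∨ ∃ v ∈ P.support, G.Adj u v} (Or.inl P.start_mem_support) hu
  simp only [Set.mem_ofPred_eq, not_or, not_exists, not_and] at hd1 hd2
  have hw : d.fst ∉ P.support := fun h => hd2.2 _ h d.adj.symm
  obtain ⟨p, hp, hwp⟩ := hd1.resolve_left hw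
  obtain ⟨m, h1, h2, h3⟩ := R.exists_longer P.isChain_adj_support hP.1.support_nodup hp hw hd2.1
    hd2.2 hwp.symm d.adj.symm
  rcases m with _ | ⟨c, m⟩
  · simp at h3
  obtain ⟨e, Q, hQ, hlen⟩ := exists_isPath_length_eq h1 h2
  have := hP.2 _ _ Q hQ
  rw [length_support, List.length_cons] at h3
  omega

theorem IsLongestPath.ecc_le_one (hP : P.IsLongestPath) (R : PlanarRep G) (hG : G.Preconnected) :
    P.ecc ≤ 1 := by
  refine ecc_le_iff.2 fun u => ?_
  rcases hP.dominating R hG u with h | ⟨v, hv, h⟩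
  · exact (iInf₂_le u h).trans (by simp)
  · exact (iInf₂_le v hv).trans (edist_eq_one_iff_adj.2 h).le

end Walk

end SimpleGraph

theorem mainTheorem7 {V : Type*} (G : SimpleGraph V) (hG : G.IsBipartitePermutationGraph)
    {a b : V} (P : G.Walk a b) (hP : P.IsLongestPath) : P.IsCentralPath := by
  obtain ⟨R⟩ := hG.nonempty_planarRep
  have hfin : Finite V := by
    obtain ⟨-, n, π, ⟨φ⟩⟩ := hG
    exact Finite.of_injective φ φ.injective
  refine ⟨hP.1, fun c d Q hQ => ?_⟩
  by_cases htop : Q.ecc = ⊤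
  · rw [htop]
    exact le_top
  by_cases hzero : Q.ecc = 0
  · rw [hP.ecc_eq_zero hQ hzero]
    exact bot_le
  · exact (hP.ecc_le_one R (SimpleGraph.Walk.preconnected_of_ecc_ne_top htop)).trans
      (Order.one_le_iff_ne_zero.2 hzero)
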